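/- Let $\overline{S_9}(n)$ denote the number of $9$-Schur overpartitions of $n$, defined by the generating function $$\sum_{n\ge 0}\overline{S_9}(n)\,q^n=\prod_{m\ge 1}\frac{(1+q^{2m-1})(1-q^{9(2m-1)})}{(1+q^{9(2m-1)})(1-q^{2m-1})}.$$ Let $p\ge 5$ be a prime with Legendre symbol $\left(\frac{-3}{p}\right)=-1$. Then for all integers $\alpha\ge 0$, $n\ge 0$ and all $i\in\{1,2,\dots,p-1\}$, $$\overline{S_9}\big(6p^{2\alpha+2}n+(6i+p)p^{2\alpha+1}\big)\equiv 0\pmod 3.$$ -/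

import Mathlib

section TSchurOverpartitions

open PowerSeries Filter
open scoped PowerSeries.WithPiTopology

/-- The factor of index `m = 2 * k + 1` of the generating product,
`(1 + q ^ m) (1 - q ^ (t m)) / ((1 + q ^ (t m)) (1 - q ^ m))`, as a formal power series in `q = X`.
For `1 ≤ t` the denominator has constant coefficient `1`, and `invOfUnit _ 1` is its inverse. -/
noncomputable def tSchurOverpartitionFactor (t k : ℕ) : ℤ⟦X⟧ :=
  (1 + X ^ (2 * k + 1)) * (1 - X ^ (t * (2 * k + 1))) *
    invOfUnit ((1 + X ^ (t * (2 * k + 1))) * (1 - X ^ (2 * k + 1))) 1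

/-- The generating function of the `t`-Schur overpartitions: the infinite product, over all odd
`m ≥ 1`, of `(1 + q ^ m) (1 - q ^ (t m)) / ((1 + q ^ (t m)) (1 - q ^ m))`. It converges in the
topology of coefficientwise convergence, see `multipliable_tSchurOverpartitionFactor`. -/
noncomputable def tSchurOverpartitionGenFun (t : ℕ) : ℤ⟦X⟧ :=
  ∏' k : ℕ, tSchurOverpartitionFactor t k

/-- The number of `t`-Schur overpartitions of `n`, defined by its generating function. -/
noncomputable def tSchurOverpartition (t n : ℕ) : ℤ :=
  coeff n (tSchurOverpartitionGenFun t)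

/-- The quotient in each factor is a genuine one. -/
theorem tSchurOverpartitionFactor_mul_denominator (t k : ℕ) (ht : 1 ≤ t) :
    tSchurOverpartitionFactor t k *
      ((1 + X ^ (t * (2 * k + 1))) * (1 - X ^ (2 * k + 1))) =
      (1 + X ^ (2 * k + 1)) * (1 - X ^ (t * (2 * k + 1))) := by
  have h0 : t * (2 * k + 1) ≠ 0 := by positivity
  rw [tSchurOverpartitionFactor, mul_assoc, invOfUnit_mul, mul_one]
  simp [h0]

/-- The infinite product converges. -/
theorem multipliable_tSchurOverpartitionFactor (t : ℕ) (ht : 1 ≤ t) :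
    Multipliable (tSchurOverpartitionFactor t) := by
  have hdvd (k : ℕ) : (X : ℤ⟦X⟧) ^ (2 * k + 1) ∣ tSchurOverpartitionFactor t k - 1 := by
    have h0 : t * (2 * k + 1) ≠ 0 := by positivity
    have hinv : ((1 + X ^ (t * (2 * k + 1))) * (1 - X ^ (2 * k + 1)) : ℤ⟦X⟧) *
        invOfUnit ((1 + X ^ (t * (2 * k + 1))) * (1 - X ^ (2 * k + 1))) 1 = 1 :=
      mul_invOfUnit _ _ (by simp [h0])
    have hle : 2 * k + 1 ≤ t * (2 * k + 1) := Nat.le_mul_of_pos_left _ ht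
    obtain ⟨c, hc⟩ := pow_dvd_pow (X : ℤ⟦X⟧) hle
    refine ⟨(2 - 2 * c) *
      invOfUnit ((1 + X ^ (t * (2 * k + 1))) * (1 - X ^ (2 * k + 1))) 1, ?_⟩
    rw [tSchurOverpartitionFactor]
    generalize invOfUnit ((1 + X ^ (t * (2 * k + 1))) * (1 - X ^ (2 * k + 1)) : ℤ⟦X⟧) 1 = v
      at hinv ⊢
    rw [hc] at hinv ⊢
    linear_combination hinv
  have h : Multipliable fun k ↦ 1 + (tSchurOverpartitionFactor t k - 1) := by
    apply WithPiTopology.multipliable_one_add_of_tendsto_order_atTop_nhds_top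
    refine ENat.tendsto_nhds_top_iff_natCast_lt.mpr fun n ↦ ?_
    filter_upwards [eventually_ge_atTop n] with k hk
    refine lt_of_lt_of_le ?_ (nat_le_order _ _ (X_pow_dvd_iff.mp (hdvd k)))
    exact_mod_cast (by omega : n < 2 * k + 1)
  simpa using h

end TSchurOverpartitions

/-!
Modulo `3`, the number of `9`-Schur overpartitions of `N ≡ 1 (mod 6)` equals the number of
representations of `N` by the form `x ^ 2 + 3 y ^ 2` (`intCast_tSchurOverpartition_nine`). An index
`N` as in the theorem is exactly divisible by an odd power of `p`, while a prime `p` at which `-3` is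
not a square divides the values of this form to even powers only (`dvd_of_sq_add_three_mul_sq_eq`),
so there is no representation at all.

Write `θ(q) = ∑ q ^ (x ^ 2)`. As `(1 ± x) ^ 9 = 1 ± x ^ 9` modulo `3`, the generating function is
congruent to the product of `((1 - q ^ m) / (1 + q ^ m)) ^ 8` over the odd `m`. Gauss's identity
`θ(-q) = ∏ (1 - q ^ n) / (1 + q ^ n)`, which follows from a telescoping finite form (`sum_gaussProd`),
turns this into `θ(-q) ^ 4 / θ(q) ^ 4` (`map_tSchurOverpartitionGenFun_nine_mul`).

Over the field with three elements, `θ(q) ^ 4 = θ(q) θ(q ^ 3)` counts the representations by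
`x ^ 2 + 3 y ^ 2`. Those of an even number come in threes, so `K = θ(q) ^ 4 - 1` is an odd series
and the generating function is `(1 - K) / (1 + K)`. Together with
`θ(q) ^ 2 + θ(-q) ^ 2 = 2 θ(q ^ 2) ^ 2` it follows that `B = (θ(q) θ(-q)) ^ 2`, whose square is
`1 - K ^ 2`, is `-1 - θ(q ^ 2) ^ 4`, so it has no exponents congruent to `1` modulo `3`. Now
`(1 - K) / (1 + K) = K + (1 + K ^ 2) / B ^ 2 + (K / B) ^ 3 B`, where the second summand is even and
the third has no exponents congruent to `1` modulo `3`: at `N ≡ 1 (mod 6)` only `K` contributes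
(`coeff_eq_of_mul_thetaSeries_pow_four`).
-/

/-! ### A finite form of Gauss's product for the alternating theta series -/

section FiniteGauss

variable {R : Type*} [CommRing R]

/-- The product of `(1 - q ^ k) / (1 + q ^ k)` over `m < k ≤ n`, where `v k` stands for the inverse
of `1 + q ^ k`. -/
def gaussProd (q : R) (v : ℕ → R) (m n : ℕ) : R :=
  ∏ k ∈ Finset.Ico m n, (1 - q ^ (k + 1)) * v (k + 1)

theorem gaussProd_succ_right (q : R) (v : ℕ → R) {m n : ℕ} (h : m ≤ n) :
    gaussProd q v m (n + 1) = gaussProd q v m n * ((1 - q ^ (n + 1)) * v (n + 1)) :=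
  Finset.prod_Ico_succ_top h _

theorem gaussProd_eq_mul_succ_left (q : R) (v : ℕ → R) {m n : ℕ} (h : m < n) :
    gaussProd q v m n = (1 - q ^ (m + 1)) * v (m + 1) * gaussProd q v (m + 1) n :=
  Finset.prod_eq_prod_Ico_succ_bot h _

theorem gaussProd_self (q : R) (v : ℕ → R) (n : ℕ) : gaussProd q v n n = 1 := by
  simp [gaussProd]

/-- The sums `∑ s ≤ n, 2 (-1) ^ s q ^ (s (n + 1)) (gaussProd q v s n) / (1 + q ^ s)` for `n + 1` and
for `n`, subtracted term by term, telescope: the difference has closed partial sums. -/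
theorem sum_gaussProd_sub (q : R) (v : ℕ → R) (hv : ∀ k, v k * (1 + q ^ k) = 1) (n m : ℕ)
    (hm : m ≤ n) :
    ∑ s ∈ Finset.range (m + 1), (-1) ^ s * 2 * v s *
        (q ^ (s * (n + 2)) * gaussProd q v s (n + 1) - q ^ (s * (n + 1)) * gaussProd q v s n) =
      (-1) ^ (m + 1) * 2 * q ^ ((m + 1) * (n + 1)) * v (n + 1) * gaussProd q v m n := by
  induction m with
  | zero =>
    have h0 := hv 0
    have h1 := hv (n + 1)
    simp only [zero_add, Finset.sum_range_one, gaussProd_succ_right q v hm, pow_zero, zero_mul,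
      one_mul, pow_one] at h0 ⊢
    linear_combination (gaussProd q v 0 n) * ((1 - q ^ (n + 1)) * v (n + 1) - 1) * h0 +
      gaussProd q v 0 n * h1
  | succ m ih =>
    have h0 := hv (m + 1)
    have h1 := hv (n + 1)
    rw [Finset.sum_range_succ, ih (by omega), gaussProd_succ_right q v hm,
      gaussProd_eq_mul_succ_left q v (show m < n by omega),
      show q ^ ((m + 1) * (n + 2)) = q ^ ((m + 1) * (n + 1)) * q ^ (m + 1) by ring,
      show q ^ ((m + 1 + 1) * (n + 1)) = q ^ ((m + 1) * (n + 1)) * q ^ (n + 1) by ring,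
      pow_succ (-1 : R) (m + 1)]
    generalize q ^ ((m + 1) * (n + 1)) = c, gaussProd q v (m + 1) n = A, (-1 : R) ^ (m + 1) = e
    generalize q ^ (m + 1) = a at *
    generalize q ^ (n + 1) = b at *
    linear_combination e * 2 * c * A * (v (m + 1) * h1 - b * v (n + 1) * h0)

/-- A finite form of Gauss's identity `∑ (-1) ^ k q ^ (k ^ 2) = ∏ (1 - q ^ n) / (1 + q ^ n)`: the
summand `s = 0` on the left is the partial product, and the others are multiples of
`q ^ (n + 1)`. -/
theorem sum_gaussProd (q : R) (v : ℕ → R) (hv : ∀ k, v k * (1 + q ^ k) = 1) (n : ℕ) :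
    ∑ s ∈ Finset.range (n + 1), (-1) ^ s * 2 * v s * (q ^ (s * (n + 1)) * gaussProd q v s n) =
      1 + 2 * ∑ k ∈ Finset.range n, (-1) ^ (k + 1) * q ^ ((k + 1) ^ 2) := by
  induction n with
  | zero =>
    have h0 := hv 0
    simp only [pow_zero] at h0
    simp [gaussProd_self]
    linear_combination h0
  | succ n ih =>
    have h1 := hv (n + 1)
    have h := sum_gaussProd_sub q v hv n n le_rfl
    simp only [mul_sub, Finset.sum_sub_distrib] at h ih
    rw [sub_eq_iff_eq_add, ih, gaussProd_self] at h
    rw [Finset.sum_range_succ, h, Finset.sum_range_succ, gaussProd_self,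
      show q ^ ((n + 1) * (n + 1 + 1)) = q ^ ((n + 1) ^ 2) * q ^ (n + 1) by ring,
      show q ^ ((n + 1) * (n + 1)) = q ^ ((n + 1) ^ 2) by ring]
    linear_combination (-1) ^ (n + 1) * 2 * q ^ ((n + 1) ^ 2) * h1

end FiniteGauss

/-! ### Series counting the points of the fibres of a map -/

section FiberSeries

open PowerSeries

/-- The power series whose coefficient at `n` is the number of `x` with `f x = n`, the fibres of `f`
being finite in all uses. -/
noncomputable def fiberSeries (R : Type*) [Semiring R] {ι : Type*} (f : ι → ℕ) : R⟦X⟧ :=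
  PowerSeries.mk fun n ↦ (Nat.card {x // f x = n} : R)

variable {R : Type*} [CommSemiring R] {ι κ : Type*}

theorem fiberSeries_mul (f : ι → ℕ) (g : κ → ℕ) (hf : ∀ n, Finite {x // f x = n})
    (hg : ∀ n, Finite {y // g y = n}) :
    fiberSeries R f * fiberSeries R g = fiberSeries R fun z : ι × κ ↦ f z.1 + g z.2 := by
  ext n
  let e : {z : ι × κ // f z.1 + g z.2 = n} ≃
      Σ ab : Finset.HasAntidiagonal.antidiagonal n, {x // f x = ab.1.1} × {y // g y = ab.1.2} :=
    { toFun := fun z ↦ ⟨⟨(f z.1.1, g z.1.2), by simpa using z.2⟩, ⟨z.1.1, rfl⟩, ⟨z.1.2, rfl⟩⟩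
      invFun := fun w ↦ ⟨(w.2.1.1, w.2.2.1), by
        rw [w.2.1.2, w.2.2.2]
        exact Finset.HasAntidiagonal.mem_antidiagonal.mp w.1.2⟩
      left_inv := fun z ↦ rfl
      right_inv := by
        rintro ⟨⟨⟨a, b⟩, h⟩, ⟨x, hx⟩, ⟨y, hy⟩⟩
        dsimp only at hx hy
        subst hx hy
        rfl }
  have hc : Nat.card {z : ι × κ // f z.1 + g z.2 = n} = ∑ ab ∈ Finset.HasAntidiagonal.antidiagonal n,
      Nat.card {x // f x = ab.1} * Nat.card {y // g y = ab.2} := by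
    rw [Nat.card_congr e, Nat.card_sigma]
    simp only [Nat.card_prod]
    exact Finset.sum_coe_sort (Finset.HasAntidiagonal.antidiagonal n)
      (fun ab ↦ Nat.card {x // f x = ab.1} * Nat.card {y // g y = ab.2})
  simp only [fiberSeries, coeff_mul, coeff_mk]
  rw [hc]
  push_cast
  rfl

theorem finite_fiber_add {f : ι → ℕ} {g : κ → ℕ} (hf : ∀ n, Finite {x // f x ≤ n})
    (hg : ∀ n, Finite {y // g y ≤ n}) (n : ℕ) :
    Finite {z : ι × κ // f z.1 + g z.2 = n} := by
  have := hf n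
  have := hg n
  refine Finite.of_injective (β := {x // f x ≤ n} × {y // g y ≤ n})
    (fun z ↦ (⟨z.1.1, by have := z.2; omega⟩, ⟨z.1.2, by have := z.2; omega⟩)) ?_
  rintro ⟨⟨x, y⟩, h⟩ ⟨⟨x', y'⟩, h'⟩ heq
  simpa using heq

end FiberSeries

/-! ### The theta series of the squares -/

section Theta

open PowerSeries

/-- The theta series `∑ q ^ (x ^ 2)` over all integers `x`. -/
noncomputable def thetaSeries (R : Type*) [Semiring R] : R⟦X⟧ :=
  fiberSeries R fun x : ℤ ↦ x.natAbs ^ 2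

theorem finite_mul_natAbs_sq_le {a : ℕ} (ha : 0 < a) (n : ℕ) :
    Finite {x : ℤ // a * x.natAbs ^ 2 ≤ n} := by
  refine Set.Finite.subset (Set.finite_Icc (-n : ℤ) n) fun x hx ↦ ?_
  have hx' : a * x.natAbs ^ 2 ≤ n := hx
  have : x.natAbs ≤ n := by nlinarith [Nat.le_self_pow two_ne_zero x.natAbs]
  rw [Set.mem_Icc]
  omega

theorem finite_mul_natAbs_sq_eq {a : ℕ} (ha : 0 < a) (n : ℕ) :
    Finite {x : ℤ // a * x.natAbs ^ 2 = n} :=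
  have := finite_mul_natAbs_sq_le ha n
  Finite.of_injective (Subtype.map (p := fun x : ℤ ↦ a * x.natAbs ^ 2 = n)
      (q := fun x : ℤ ↦ a * x.natAbs ^ 2 ≤ n) id fun _ hx ↦ le_of_eq hx)
    (Subtype.map_injective _ Function.injective_id)

theorem coeff_thetaSeries_zero (R : Type*) [Semiring R] : coeff 0 (thetaSeries R) = 1 := by
  have : Nat.card {x : ℤ // x.natAbs ^ 2 = 0} = 1 := by simp
  simp only [thetaSeries, fiberSeries, coeff_mk, this, Nat.cast_one]

theorem coeff_thetaSeries_sq (R : Type*) [Semiring R] (k : ℕ) :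
    coeff ((k + 1) ^ 2) (thetaSeries R) = 2 := by
  have h : {x : ℤ | x.natAbs ^ 2 = (k + 1) ^ 2} = {(k + 1 : ℤ), -(k + 1 : ℤ)} := by
    ext x
    rw [Set.mem_ofPred_eq, Nat.pow_left_injective two_ne_zero |>.eq_iff]
    simp only [Set.mem_insert_iff, Set.mem_singleton_iff]
    omega
  have : Nat.card {x : ℤ // x.natAbs ^ 2 = (k + 1) ^ 2} = 2 := by
    change Set.ncard {x : ℤ | x.natAbs ^ 2 = (k + 1) ^ 2} = 2
    rw [h, Set.ncard_pair (by omega)]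
  simp only [thetaSeries, fiberSeries, coeff_mk, this, Nat.cast_ofNat]

theorem coeff_thetaSeries_of_not_isSquare (R : Type*) [Semiring R] {n : ℕ} (h : ¬ IsSquare n) :
    coeff n (thetaSeries R) = 0 := by
  have : IsEmpty {x : ℤ // x.natAbs ^ 2 = n} := ⟨fun x ↦ h ⟨x.1.natAbs, by rw [← sq, x.2]⟩⟩
  simp [thetaSeries, fiberSeries]

theorem X_pow_dvd_thetaSeries_sub (R : Type*) [CommRing R] (n : ℕ) :
    (X : R⟦X⟧) ^ (n + 1) ∣
      thetaSeries R - (1 + 2 * ∑ k ∈ Finset.range n, X ^ ((k + 1) ^ 2)) := by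
  refine X_pow_dvd_iff.mpr fun m hm ↦ ?_
  have h2 (f : R⟦X⟧) : coeff m (2 * f) = 2 * coeff m f := by simp [two_mul]
  rw [map_sub, map_add, h2, map_sum]
  simp only [coeff_X_pow, coeff_one]
  by_cases hsq : IsSquare m
  · obtain ⟨j, rfl⟩ := hsq
    cases j with
    | zero =>
      have h0 (k : ℕ) : 0 ≠ (k + 1) ^ 2 := by positivity
      simp [coeff_thetaSeries_zero, h0]
    | succ j =>
      have hj : j < n := by nlinarith
      rw [← sq, coeff_thetaSeries_sq, if_neg (by positivity), Finset.sum_eq_single j]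
      · simp
      · intro k _ hk
        refine if_neg fun h ↦ hk ?_
        have := Nat.pow_left_injective two_ne_zero h
        omega
      · exact fun h ↦ absurd (Finset.mem_range.mpr hj) h
  · rw [coeff_thetaSeries_of_not_isSquare R hsq, if_neg (by rintro rfl; exact hsq ⟨0, rfl⟩),
      Finset.sum_eq_zero fun k _ ↦ if_neg fun h ↦ hsq ⟨k + 1, by rw [h, sq]⟩]
    simp

theorem X_pow_dvd_evalNegHom {R : Type*} [CommRing R] {n : ℕ} {f : R⟦X⟧} (h : X ^ n ∣ f) :
    X ^ n ∣ evalNegHom f := by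
  refine dvd_trans ?_ (map_dvd evalNegHom h)
  rw [map_pow, evalNegHom_X, neg_pow]
  exact dvd_mul_left _ _

theorem evalNegHom_evalNegHom {R : Type*} [CommRing R] (f : R⟦X⟧) :
    evalNegHom (evalNegHom f) = f := by
  ext n
  rw [evalNegHom, coeff_rescale, coeff_rescale, ← mul_assoc, ← mul_pow]
  simp

end Theta

/-! ### Gauss's product -/

section GaussProduct

open PowerSeries

variable {F : Type*} [Field F]

theorem inv_one_add_X_pow_mul (h2 : (2 : F) ≠ 0) (k : ℕ) :
    (1 + X ^ k : F⟦X⟧)⁻¹ * (1 + X ^ k) = 1 := by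
  refine PowerSeries.inv_mul_cancel _ ?_
  cases k with
  | zero => rwa [pow_zero, map_add, map_one, one_add_one_eq_two]
  | succ k => simp

theorem X_pow_dvd_gaussProd_sub_evalNegHom_thetaSeries (h2 : (2 : F) ≠ 0) (n : ℕ) :
    (X : F⟦X⟧) ^ (n + 1) ∣
      gaussProd X (fun k ↦ (1 + X ^ k)⁻¹) 0 n - evalNegHom (thetaSeries F) := by
  have hv := inv_one_add_X_pow_mul h2
  have h0 := hv 0
  have h := sum_gaussProd (X : F⟦X⟧) (fun k ↦ (1 + X ^ k)⁻¹) hv n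
  rw [Finset.sum_range_succ'] at h
  have hd : (X : F⟦X⟧) ^ (n + 1) ∣ ∑ s ∈ Finset.range n, (-1) ^ (s + 1) * 2 * (1 + X ^ (s + 1))⁻¹ *
      (X ^ ((s + 1) * (n + 1)) * gaussProd X (fun k ↦ (1 + X ^ k)⁻¹) (s + 1) n) :=
    Finset.dvd_sum fun s _ ↦ Dvd.dvd.mul_left (Dvd.dvd.mul_right
      (pow_dvd_pow _ (Nat.le_mul_of_pos_left _ s.succ_pos)) _) _
  have ht := X_pow_dvd_evalNegHom (X_pow_dvd_thetaSeries_sub F n)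
  have hs : evalNegHom (1 + 2 * ∑ k ∈ Finset.range n, (X : F⟦X⟧) ^ ((k + 1) ^ 2)) =
      1 + 2 * ∑ k ∈ Finset.range n, (-1) ^ (k + 1) * X ^ ((k + 1) ^ 2) := by
    simp only [map_add, map_mul, map_one, map_ofNat, map_sum, map_pow, evalNegHom_X]
    congr 2
    refine Finset.sum_congr rfl fun k _ ↦ ?_
    rw [neg_pow]
    congr 1
    rcases Nat.even_or_odd (k + 1) with hk | hk
    · rw [hk.neg_one_pow, (hk.pow_of_ne_zero two_ne_zero).neg_one_pow]
    · rw [hk.neg_one_pow, hk.pow.neg_one_pow]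
  rw [map_sub, hs, ← h] at ht
  convert (dvd_add hd ht).neg_right using 1
  simp only [pow_zero, zero_mul] at h0 ⊢
  linear_combination (-gaussProd X (fun k ↦ (1 + X ^ k : F⟦X⟧)⁻¹) 0 n) * h0

/-- Gauss's product for `θ(-q)` and the one for `θ(q)` differ only in the factors with odd index,
whence `θ(-q) / θ(q) = ∏ ((1 - q ^ m) / (1 + q ^ m)) ^ 2` over the odd `m`. -/
theorem X_pow_dvd_thetaSeries_mul_prod_sub (h2 : (2 : F) ≠ 0) (n : ℕ) :
    (X : F⟦X⟧) ^ (2 * n + 1) ∣ thetaSeries F *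
      (∏ k ∈ Finset.range n, (1 - X ^ (2 * k + 1)) * (1 + X ^ (2 * k + 1))⁻¹) ^ 2 -
        evalNegHom (thetaSeries F) := by
  have hG (n : ℕ) : gaussProd X (fun k ↦ (1 + X ^ k : F⟦X⟧)⁻¹) 0 (2 * n) =
      evalNegHom (gaussProd X (fun k ↦ (1 + X ^ k : F⟦X⟧)⁻¹) 0 (2 * n)) *
      (∏ k ∈ Finset.range n, (1 - X ^ (2 * k + 1)) * (1 + X ^ (2 * k + 1))⁻¹) ^ 2 := by
    induction n with
    | zero => simp [gaussProd]
    | succ n ih =>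
      rw [show 2 * (n + 1) = 2 * n + 1 + 1 by ring, gaussProd_succ_right _ _ (Nat.zero_le _),
        gaussProd_succ_right _ _ (Nat.zero_le _), Finset.prod_range_succ]
      have ho := inv_one_add_X_pow_mul h2 (2 * n + 1)
      have he := inv_one_add_X_pow_mul h2 (2 * n + 1 + 1)
      have ho' := congrArg evalNegHom ho
      have he' := congrArg evalNegHom he
      have hodd : Odd (2 * n + 1) := odd_two_mul_add_one n
      have heven : Even (2 * n + 1 + 1) := hodd.add_one
      simp only [map_mul, map_add, map_one, map_pow, map_sub, evalNegHom_X, hodd.neg_pow,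
        heven.neg_pow] at ho' he' ⊢
      generalize (X : F⟦X⟧) ^ (2 * n + 1) = a at *
      generalize (X : F⟦X⟧) ^ (2 * n + 1 + 1) = b at *
      generalize evalNegHom (1 + b)⁻¹ = vb at *
      generalize evalNegHom (1 + a)⁻¹ = va at *
      generalize (1 + b)⁻¹ = wb at *
      generalize (1 + a)⁻¹ = wa at *
      have hb : vb = wb := by linear_combination wb * he' - vb * he
      subst hb
      set O := ∏ k ∈ Finset.range n, (1 - X ^ (2 * k + 1)) * (1 + X ^ (2 * k + 1) : F⟦X⟧)⁻¹
      set G := gaussProd X (fun k ↦ (1 + X ^ k : F⟦X⟧)⁻¹) 0 (2 * n)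
      linear_combination (1 - a) * wa * (1 - b) * vb * ih -
        evalNegHom G * O ^ 2 * (1 - b) * vb * (1 - a) * wa * (va * (1 + -a) * ho + ho')
  have h := X_pow_dvd_gaussProd_sub_evalNegHom_thetaSeries h2 (2 * n)
  have h' := X_pow_dvd_evalNegHom h
  rw [map_sub, evalNegHom_evalNegHom] at h'
  convert dvd_sub h (h'.mul_right
    ((∏ k ∈ Finset.range n, (1 - X ^ (2 * k + 1)) * (1 + X ^ (2 * k + 1))⁻¹) ^ 2)) using 1
  linear_combination -hG n

end GaussProduct

/-! ### Representations by `x ^ 2 + y ^ 2` and `x ^ 2 + 3 y ^ 2` -/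

section Representations

open PowerSeries

theorem thetaSeries_sq (R : Type*) [CommSemiring R] :
    thetaSeries R ^ 2 = fiberSeries R fun z : ℤ × ℤ ↦ z.1.natAbs ^ 2 + z.2.natAbs ^ 2 := by
  have h (n : ℕ) : Finite {x : ℤ // x.natAbs ^ 2 = n} := by
    simpa using finite_mul_natAbs_sq_eq one_pos n
  rw [sq, thetaSeries, fiberSeries_mul _ _ h h]

theorem expand_fiberSeries (R : Type*) [CommRing R] {ι : Type*} (f : ι → ℕ) {a : ℕ} (ha : a ≠ 0) :
    expand a ha (fiberSeries R f) = fiberSeries R fun x ↦ a * f x := by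
  ext n
  rw [coeff_expand]
  split_ifs with h
  · obtain ⟨m, rfl⟩ := h
    simp [fiberSeries, ha]
  · have : IsEmpty {x // a * f x = n} := ⟨fun x ↦ h ⟨f x.1, x.2.symm⟩⟩
    simp [fiberSeries]

/-- The rotation `(x, y) ↦ (x + y, x - y)` matches the representations of `n` and of `2 n` as sums
of two squares. -/
theorem card_sum_two_sq_two_mul (n : ℕ) :
    Nat.card {z : ℤ × ℤ // z.1.natAbs ^ 2 + z.2.natAbs ^ 2 = 2 * n} =
      Nat.card {z : ℤ × ℤ // z.1.natAbs ^ 2 + z.2.natAbs ^ 2 = n} := by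
  symm
  refine Nat.card_eq_of_bijective (fun z ↦ ⟨(z.1.1 + z.1.2, z.1.1 - z.1.2), ?_⟩) ⟨?_, ?_⟩
  · have := z.2
    zify at this ⊢
    simp only [sq_abs] at this ⊢
    linear_combination 2 * this
  · rintro ⟨⟨x, y⟩, h⟩ ⟨⟨x', y'⟩, h'⟩ heq
    simp only [Subtype.mk.injEq, Prod.mk.injEq] at heq ⊢
    omega
  · rintro ⟨⟨x, y⟩, h⟩
    have h1 : x ^ 2 + y ^ 2 = 2 * n := by
      zify at h
      simpa only [sq_abs] using h
    have h2 : Even (x + y) := by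
      have h3 : Even (x ^ 2 + y ^ 2) := ⟨n, by rw [h1]; ring⟩
      simpa [Int.even_add, Int.even_pow] using h3
    obtain ⟨a, ha⟩ := h2
    refine ⟨⟨(a, x - a), ?_⟩, ?_⟩
    · have hy : y = 2 * a - x := by omega
      subst hy
      zify
      simp only [sq_abs]
      linarith
    · simp only [Subtype.mk.injEq, Prod.mk.injEq]
      omega

theorem finite_sq_add_three_mul_sq (n : ℕ) :
    Finite {z : ℤ × ℤ // z.1.natAbs ^ 2 + 3 * z.2.natAbs ^ 2 = n} :=
  finite_fiber_add (fun n ↦ by simpa using finite_mul_natAbs_sq_le one_pos n)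
    (finite_mul_natAbs_sq_le three_pos) n

/-- In a representation of an even `n > 0` by `x ^ 2 + 3 y ^ 2` the parities of `x` and `y` agree, so
multiplying `x + y √-3` by the cube root of unity `(-1 + √-3) / 2` gives another representation.
This action of the group of order three has no fixed point. -/
theorem three_dvd_card_sq_add_three_mul_sq {n : ℕ} (hn : Even n) (h0 : n ≠ 0) :
    3 ∣ Nat.card {z : ℤ × ℤ // z.1.natAbs ^ 2 + 3 * z.2.natAbs ^ 2 = n} := by
  classical
  set T := {z : ℤ × ℤ // z.1.natAbs ^ 2 + 3 * z.2.natAbs ^ 2 = n}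
  have hfin : Finite T := finite_sq_add_three_mul_sq n
  have : Fintype T := Fintype.ofFinite T
  have hT (z : T) : z.1.1 ^ 2 + 3 * z.1.2 ^ 2 = n := by
    have h := z.2
    zify at h
    simpa only [sq_abs] using h
  have hpar (z : T) : Even (z.1.1 + z.1.2) := by
    have h1 : Even (z.1.1 ^ 2 + 3 * z.1.2 ^ 2) := by
      rw [hT z]
      exact_mod_cast hn
    simpa [Int.even_add, Int.even_mul, Int.even_pow, show ¬ Even (3 : ℤ) by decide] using h1
  let f : Function.End T := fun z ↦ ⟨((-z.1.1 - 3 * z.1.2) / 2, (z.1.1 - z.1.2) / 2), by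
    obtain ⟨a, ha⟩ := hpar z
    have h := hT z
    have h1 : (-z.1.1 - 3 * z.1.2) / 2 = -a - z.1.2 := by omega
    have h2 : (z.1.1 - z.1.2) / 2 = a - z.1.2 := by omega
    zify
    simp only [sq_abs, h1, h2]
    rw [show z.1.1 = 2 * a - z.1.2 by omega] at h
    linarith⟩
  have hf1 (z : T) : (f z).1.1 = (-z.1.1 - 3 * z.1.2) / 2 := rfl
  have hf2 (z : T) : (f z).1.2 = (z.1.1 - z.1.2) / 2 := rfl
  have hf : f ^ 3 ^ 1 = 1 := by
    funext z
    change f (f (f z)) = z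
    obtain ⟨a, ha⟩ := hpar z
    refine Subtype.ext (Prod.ext ?_ ?_) <;> simp only [hf1, hf2] <;> omega
  have hfix : IsEmpty (Function.fixedPoints f) := ⟨fun z ↦ by
    have hz : f z.1 = z.1 := z.2
    have h1 : (f z.1).1.1 = z.1.1.1 := by rw [hz]
    have h2 : (f z.1).1.2 = z.1.1.2 := by rw [hz]
    rw [hf1] at h1
    rw [hf2] at h2
    obtain ⟨a, ha⟩ := hpar z.1
    have hx : z.1.1.1 = 0 := by omega
    have hy : z.1.1.2 = 0 := by omega
    have h := hT z.1
    rw [hx, hy] at h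
    norm_num at h
    exact h0 (by exact_mod_cast h.symm)⟩
  have h := Equiv.Perm.card_fixedPoints_modEq hf
  rw [Fintype.card_eq_zero (α := Function.fixedPoints f)] at h
  rw [Nat.card_eq_fintype_card]
  exact (Nat.modEq_zero_iff_dvd).mp h

/-- A prime at which `-3` is not a square divides a number of the form `x ^ 2 + 3 y ^ 2` to an even
power. -/
theorem dvd_of_sq_add_three_mul_sq_eq {p : ℕ} [Fact p.Prime] (hp : legendreSym p (-3) = -1)
    (a : ℕ) {x y m : ℤ} (h : x ^ 2 + 3 * y ^ 2 = p ^ (2 * a + 1) * m) : (p : ℤ) ∣ m := by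
  have hp0 : (p : ℤ) ≠ 0 := by exact_mod_cast (Fact.out : p.Prime).ne_zero
  induction a generalizing x y with
  | zero =>
    obtain ⟨⟨b, rfl⟩, ⟨c, rfl⟩⟩ := legendreSym.prime_dvd_of_eq_neg_one hp (x := x) (y := y)
      ⟨m, by linear_combination h⟩
    refine ⟨b ^ 2 + 3 * c ^ 2, mul_left_cancel₀ hp0 ?_⟩
    linear_combination -h
  | succ a ih =>
    obtain ⟨⟨b, rfl⟩, ⟨c, rfl⟩⟩ := legendreSym.prime_dvd_of_eq_neg_one hp (x := x) (y := y)
      ⟨p ^ (2 * a + 2) * m, by linear_combination h⟩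
    refine ih (x := b) (y := c) (mul_left_cancel₀ (pow_ne_zero 2 hp0) ?_)
    linear_combination h

end Representations

/-! ### Theta identities modulo 3 -/

section ModThree

open PowerSeries

theorem cube_eq_expand (f : (ZMod 3)⟦X⟧) : f ^ 3 = expand 3 three_ne_zero f := by
  have h := MvPowerSeries.map_frobenius_expand 3 three_ne_zero (R := ZMod 3) (f := f)
  rw [ZMod.frobenius_zmod, MvPowerSeries.map_id] at h
  exact h.symm

instance charP_powerSeries_zmod_three : CharP (ZMod 3)⟦X⟧ 3 :=
  charP_of_injective_ringHom C_injective 3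

theorem powerSeries_three_eq_zero : (3 : (ZMod 3)⟦X⟧) = 0 := by
  have : ((3 : ℕ) : (ZMod 3)⟦X⟧) = 0 := CharP.cast_eq_zero _ 3
  exact_mod_cast this

/-- Modulo `3`, the fourth power of the theta series counts the representations by
`x ^ 2 + 3 y ^ 2`. -/
theorem thetaSeries_pow_four : thetaSeries (ZMod 3) ^ 4 =
    fiberSeries (ZMod 3) fun z : ℤ × ℤ ↦ z.1.natAbs ^ 2 + 3 * z.2.natAbs ^ 2 := by
  rw [show 4 = 1 + 3 from rfl, pow_add, cube_eq_expand, pow_one, thetaSeries, expand_fiberSeries]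
  exact fiberSeries_mul _ _ (fun n ↦ by simpa using finite_mul_natAbs_sq_eq one_pos n)
    (finite_mul_natAbs_sq_eq three_pos)

theorem coeff_evalNegHom {R : Type*} [CommRing R] (f : R⟦X⟧) (n : ℕ) :
    coeff n (evalNegHom f) = (-1) ^ n * coeff n f :=
  coeff_rescale f _ n

theorem thetaSeries_sq_add_evalNegHom_sq (R : Type*) [CommRing R] :
    thetaSeries R ^ 2 + evalNegHom (thetaSeries R) ^ 2 =
      2 * expand 2 two_ne_zero (thetaSeries R) ^ 2 := by
  rw [← map_pow, ← map_pow, thetaSeries_sq]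
  ext n
  rw [map_add, coeff_evalNegHom, two_mul, map_add, coeff_expand]
  rcases Nat.even_or_odd n with hn | hn
  · rw [hn.neg_one_pow, one_mul, if_pos hn.two_dvd]
    obtain ⟨m, rfl⟩ := hn.two_dvd
    rw [Nat.mul_div_cancel_left m two_pos]
    simp only [fiberSeries, coeff_mk, card_sum_two_sq_two_mul]
  · rw [hn.neg_one_pow, if_neg hn.not_two_dvd_nat]
    ring

/-- The even part of `θ ^ 4` is constant modulo `3`, the representations of an even number by
`x ^ 2 + 3 y ^ 2` coming in threes. -/
theorem thetaSeries_pow_four_add_evalNegHom :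
    thetaSeries (ZMod 3) ^ 4 + evalNegHom (thetaSeries (ZMod 3)) ^ 4 = 2 := by
  have h0 : coeff 0 (thetaSeries (ZMod 3) ^ 4) = 1 := by
    rw [coeff_zero_eq_constantCoeff, map_pow, ← coeff_zero_eq_constantCoeff_apply,
      coeff_thetaSeries_zero, one_pow]
  rw [← map_pow]
  ext n
  rw [← one_add_one_eq_two, map_add, map_add, coeff_evalNegHom]
  rcases Nat.even_or_odd n with hn | hn
  · rw [hn.neg_one_pow, one_mul, coeff_one]
    split_ifs with hz
    · rw [hz, h0]
    · have h : coeff n (thetaSeries (ZMod 3) ^ 4) = 0 := by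
        rw [thetaSeries_pow_four, fiberSeries, coeff_mk]
        exact (ZMod.natCast_eq_zero_iff _ 3).mpr (three_dvd_card_sq_add_three_mul_sq hn hz)
      rw [h]
  · rw [hn.neg_one_pow, coeff_one, if_neg hn.pos.ne']
    ring

/-- The exponents in `θ ^ 4` are modulo `3` of the form `x ^ 2 + 3 y ^ 2`. -/
theorem coeff_thetaSeries_pow_four_eq_zero {n : ℕ} (hn : n % 3 = 2) :
    coeff n (thetaSeries (ZMod 3) ^ 4) = 0 := by
  have : IsEmpty {z : ℤ × ℤ // z.1.natAbs ^ 2 + 3 * z.2.natAbs ^ 2 = n} := ⟨fun z ↦ by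
    have h := congrArg (· % 3) z.2
    have h1 := Nat.pow_mod z.1.1.natAbs 2 3
    have h2 : z.1.1.natAbs % 3 < 3 := Nat.mod_lt _ three_pos
    simp only [Nat.add_mul_mod_self_left, hn] at h
    generalize z.1.1.natAbs % 3 = r at h1 h2
    interval_cases r <;> omega⟩
  rw [thetaSeries_pow_four, fiberSeries, coeff_mk, Nat.card_of_isEmpty, Nat.cast_zero]

/-- Modulo `3` the square of `θ(q) θ(-q)` is `-1 - θ(q ^ 2) ^ 4`, as `θ(q) ^ 4 + θ(-q) ^ 4 = 2`. Hence
it has no exponents congruent to `1`. -/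
theorem coeff_thetaSeries_sq_mul_evalNegHom_sq_eq_zero {n : ℕ} (hn : n % 3 = 1) :
    coeff n ((thetaSeries (ZMod 3) * evalNegHom (thetaSeries (ZMod 3))) ^ 2) = 0 := by
  have h2 := thetaSeries_sq_add_evalNegHom_sq (ZMod 3)
  have h4 := thetaSeries_pow_four_add_evalNegHom
  have h3 := powerSeries_three_eq_zero
  have h : (thetaSeries (ZMod 3) * evalNegHom (thetaSeries (ZMod 3))) ^ 2 =
      - 1 - expand 2 two_ne_zero (thetaSeries (ZMod 3) ^ 4) := by
    rw [map_pow]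
    generalize thetaSeries (ZMod 3) = t at *
    generalize evalNegHom t = s at *
    generalize expand 2 two_ne_zero t = e at *
    linear_combination (-(t ^ 2 + s ^ 2) - 2 * e ^ 2) * h2 + h4 + (t ^ 2 * s ^ 2 + 1 - e ^ 4) * h3
  rw [h, map_sub, map_neg, coeff_one, if_neg (by omega), coeff_expand]
  split_ifs with hd
  · rw [coeff_thetaSeries_pow_four_eq_zero (by omega)]
    simp
  · simp

theorem coeff_cube_mul_eq_zero (f g : (ZMod 3)⟦X⟧) (hg : ∀ n, n % 3 = 1 → coeff n g = 0) {n : ℕ}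
    (hn : n % 3 = 1) : coeff n (f ^ 3 * g) = 0 := by
  rw [cube_eq_expand, coeff_mul]
  refine Finset.sum_eq_zero fun ab hab ↦ ?_
  rw [Finset.HasAntidiagonal.mem_antidiagonal] at hab
  by_cases h : 3 ∣ ab.1
  · rw [hg _ (by omega), mul_zero]
  · rw [coeff_expand_of_not_dvd _ _ _ h, zero_mul]

/-- With `K = θ(q) ^ 4 - 1`, an odd series, and `B = (θ(q) θ(-q)) ^ 2`, so that `B ^ 2 = 1 - K ^ 2`,
the quotient `θ(-q) ^ 4 / θ(q) ^ 4` is `(1 - K) / (1 + K)`. It differs from `K` by the even series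
`(1 + K ^ 2) / B ^ 2` and by `(K / B) ^ 3 * B`, which has no exponents congruent to `1` modulo `3`. -/
theorem coeff_eq_of_mul_thetaSeries_pow_four {u : (ZMod 3)⟦X⟧}
    (hu : u * thetaSeries (ZMod 3) ^ 4 = evalNegHom (thetaSeries (ZMod 3)) ^ 4) {n : ℕ}
    (hn : n % 6 = 1) : coeff n u = coeff n (thetaSeries (ZMod 3) ^ 4) := by
  have h3 := powerSeries_three_eq_zero
  have h4 := thetaSeries_pow_four_add_evalNegHom
  have hB (m : ℕ) (hm : m % 3 = 1) := coeff_thetaSeries_sq_mul_evalNegHom_sq_eq_zero hm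
  have hBσ : evalNegHom ((thetaSeries (ZMod 3) * evalNegHom (thetaSeries (ZMod 3))) ^ 2) =
      (thetaSeries (ZMod 3) * evalNegHom (thetaSeries (ZMod 3))) ^ 2 := by
    rw [map_pow, map_mul, evalNegHom_evalNegHom, mul_comm]
  have hKσ : evalNegHom (thetaSeries (ZMod 3) ^ 4 - 1) = -(thetaSeries (ZMod 3) ^ 4 - 1) := by
    rw [map_sub, map_pow, map_one]
    linear_combination h4
  have hB0 : constantCoeff ((thetaSeries (ZMod 3) * evalNegHom (thetaSeries (ZMod 3))) ^ 2) ≠ 0 := by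
    rw [← coeff_zero_eq_constantCoeff_apply, coeff_zero_eq_constantCoeff, map_pow, map_mul,
      ← coeff_zero_eq_constantCoeff_apply, ← coeff_zero_eq_constantCoeff_apply, coeff_evalNegHom,
      coeff_thetaSeries_zero]
    simp
  have hBK : ((thetaSeries (ZMod 3) * evalNegHom (thetaSeries (ZMod 3))) ^ 2) ^ 2 =
      1 - (thetaSeries (ZMod 3) ^ 4 - 1) ^ 2 := by
    linear_combination thetaSeries (ZMod 3) ^ 4 * h4
  have huK : u * (1 + (thetaSeries (ZMod 3) ^ 4 - 1)) = 1 - (thetaSeries (ZMod 3) ^ 4 - 1) := by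
    linear_combination hu + h4
  have hK : coeff n (thetaSeries (ZMod 3) ^ 4) = coeff n (thetaSeries (ZMod 3) ^ 4 - 1) := by
    rw [map_sub, coeff_one, if_neg (by omega), sub_zero]
  rw [hK]
  generalize (thetaSeries (ZMod 3) * evalNegHom (thetaSeries (ZMod 3))) ^ 2 = B at *
  generalize thetaSeries (ZMod 3) ^ 4 - 1 = K at *
  have hV : B⁻¹ * B = 1 := PowerSeries.inv_mul_cancel B hB0
  have hVσ : evalNegHom B⁻¹ = B⁻¹ := by
    have h := congrArg evalNegHom hV
    rw [map_mul, hBσ, map_one] at h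
    linear_combination B⁻¹ * h - evalNegHom B⁻¹ * hV
  generalize B⁻¹ = V at *
  have hmain : u = K + V ^ 2 * (1 + K ^ 2) + (K * V) ^ 3 * B := by
    have hB2 : B ^ 2 ≠ 0 := by
      intro h
      have : (1 : (ZMod 3)⟦X⟧) = 0 := by
        linear_combination V ^ 2 * h - (V * B + 1) * hV
      exact one_ne_zero this
    refine mul_right_cancel₀ hB2 ?_
    linear_combination (u - K) * hBK + (1 - K) * huK - K * h3 -
      ((1 + K ^ 2) * (V * B + 1) + K ^ 3 * (V ^ 2 * B ^ 2 + V * B + 1)) * hV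
  have heven : coeff n (V ^ 2 * (1 + K ^ 2)) = 0 := by
    have h : evalNegHom (V ^ 2 * (1 + K ^ 2)) = V ^ 2 * (1 + K ^ 2) := by
      simp only [map_mul, map_add, map_pow, map_one, hVσ, hKσ, neg_sq]
    have hodd : Odd n := Nat.odd_iff.mpr (by omega)
    have h' := congrArg (coeff n) h
    rw [coeff_evalNegHom, hodd.neg_one_pow] at h'
    generalize coeff n (V ^ 2 * (1 + K ^ 2)) = c at h'
    revert c
    decide
  rw [hmain, map_add, map_add, heven, coeff_cube_mul_eq_zero _ _ hB (by omega), add_zero, add_zero]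

end ModThree

/-! ### The generating function modulo 3 -/

section GeneratingFunction

open PowerSeries Filter
open scoped PowerSeries.WithPiTopology

/-- Modulo `3` the ninth power is additive, so that the factor with `x = q ^ m` becomes
`(1 + x) (1 - x) ^ 9 / ((1 + x) ^ 9 (1 - x))`. -/
theorem map_tSchurOverpartitionFactor_nine (k : ℕ) :
    PowerSeries.map (Int.castRingHom (ZMod 3)) (tSchurOverpartitionFactor 9 k) =
      ((1 - X ^ (2 * k + 1)) * (1 + X ^ (2 * k + 1))⁻¹) ^ 8 := by
  have h := congrArg (PowerSeries.map (Int.castRingHom (ZMod 3)))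
    (tSchurOverpartitionFactor_mul_denominator 9 k (by norm_num))
  have hv := inv_one_add_X_pow_mul (F := ZMod 3) (by decide) (2 * k + 1)
  have h1 (f : (ZMod 3)⟦X⟧) : 1 + f ^ 9 = (1 + f) ^ 9 := by
    have := add_pow_char_pow (p := 3) (n := 2) (1 : (ZMod 3)⟦X⟧) f
    norm_num at this
    exact this.symm
  have h2 (f : (ZMod 3)⟦X⟧) : 1 - f ^ 9 = (1 - f) ^ 9 := by
    have := sub_pow_char_pow (p := 3) (n := 2) (1 : (ZMod 3)⟦X⟧) f
    norm_num at this
    exact this.symm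
  have hne : (1 - X ^ (2 * k + 1) : (ZMod 3)⟦X⟧) ≠ 0 := by
    intro h0
    simpa using congrArg constantCoeff h0
  simp only [map_mul, map_add, map_sub, map_one, map_pow, PowerSeries.map_X, mul_comm 9, pow_mul,
    h1, h2] at h
  generalize PowerSeries.map (Int.castRingHom (ZMod 3)) (tSchurOverpartitionFactor 9 k) = u at *
  generalize (X : (ZMod 3)⟦X⟧) ^ (2 * k + 1) = a at *
  generalize (1 + a)⁻¹ = v at *
  refine mul_right_cancel₀ hne ?_
  have hv9 : (v * (1 + a)) ^ 9 = 1 := by rw [hv, one_pow]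
  linear_combination v ^ 9 * h - u * (1 - a) * hv9 + v ^ 8 * (1 - a) ^ 9 * hv

/-- Modulo `3` the generating function of the `9`-Schur overpartitions is
`θ(-q) ^ 4 / θ(q) ^ 4`. -/
theorem map_tSchurOverpartitionGenFun_nine_mul :
    PowerSeries.map (Int.castRingHom (ZMod 3)) (tSchurOverpartitionGenFun 9) *
      thetaSeries (ZMod 3) ^ 4 = evalNegHom (thetaSeries (ZMod 3)) ^ 4 := by
  rw [← sub_eq_zero]
  ext n
  -- The topology on `ℤ` is discrete, so that the coefficients of the infinite product up to `n`
  -- are those of a long partial product.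
  have htend := (multipliable_tSchurOverpartitionFactor 9 (by norm_num)).hasProd.tendsto_prod_nat
  have hev : ∀ᶠ N in atTop, ∀ j ∈ Finset.range (n + 1),
      coeff j (∏ k ∈ Finset.range N, tSchurOverpartitionFactor 9 k) =
        coeff j (tSchurOverpartitionGenFun 9) := by
    refine (Finset.eventually_all _).mpr fun j _ ↦ ?_
    have h := ((WithPiTopology.continuous_coeff ℤ j).tendsto _).comp htend
    rw [nhds_discrete, tendsto_pure] at h
    exact h
  obtain ⟨N, hN, hnN⟩ := (hev.and (eventually_ge_atTop n)).exists
  set P : (ZMod 3)⟦X⟧ :=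
    ∏ k ∈ Finset.range N, (1 - X ^ (2 * k + 1)) * (1 + X ^ (2 * k + 1))⁻¹
  have hP : PowerSeries.map (Int.castRingHom (ZMod 3))
      (∏ k ∈ Finset.range N, tSchurOverpartitionFactor 9 k) = P ^ 8 := by
    rw [map_prod, ← Finset.prod_pow]
    exact Finset.prod_congr rfl fun k _ ↦ map_tSchurOverpartitionFactor_nine k
  have h1 : X ^ (n + 1) ∣
      PowerSeries.map (Int.castRingHom (ZMod 3)) (tSchurOverpartitionGenFun 9) - P ^ 8 := by
    refine X_pow_dvd_iff.mpr fun j hj ↦ ?_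
    rw [map_sub, ← hP, coeff_map, coeff_map, hN j (Finset.mem_range.mpr hj), sub_self]
  have h2 : X ^ (n + 1) ∣
      (thetaSeries (ZMod 3) * P ^ 2) ^ 4 - evalNegHom (thetaSeries (ZMod 3)) ^ 4 :=
    ((pow_dvd_pow X (by omega)).trans
      (X_pow_dvd_thetaSeries_mul_prod_sub (F := ZMod 3) (by decide) N)).trans
        (sub_dvd_pow_sub_pow _ _ 4)
  have h3 := dvd_add (h1.mul_right (thetaSeries (ZMod 3) ^ 4)) h2
  have h4 := X_pow_dvd_iff.mp h3 n n.lt_succ_self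
  rw [map_zero, ← h4]
  congr 1
  ring

/-- For `n` congruent to `1` modulo `6`, the number of `9`-Schur overpartitions of `n` is congruent
modulo `3` to the number of representations of `n` by `x ^ 2 + 3 y ^ 2`. -/
theorem intCast_tSchurOverpartition_nine {n : ℕ} (hn : n % 6 = 1) :
    (tSchurOverpartition 9 n : ZMod 3) =
      Nat.card {z : ℤ × ℤ // z.1.natAbs ^ 2 + 3 * z.2.natAbs ^ 2 = n} := by
  have h := coeff_eq_of_mul_thetaSeries_pow_four map_tSchurOverpartitionGenFun_nine_mul hn
  rw [coeff_map, thetaSeries_pow_four, fiberSeries, coeff_mk] at h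
  exact h

end GeneratingFunction

theorem theorem3p4 (p : ℕ) [Fact p.Prime] (hp5 : 5 ≤ p) (hp : legendreSym p (-3) = -1)
    (α n i : ℕ) (hi1 : 1 ≤ i) (hi2 : i ≤ p - 1) :
    tSchurOverpartition 9
      (6 * p ^ (2 * α + 2) * n + (6 * i + p) * p ^ (2 * α + 1)) ≡ 0 [ZMOD 3] := by
  have hpp : p.Prime := Fact.out
  -- `p` is coprime to `6`, so its even powers are congruent to `1` modulo `6`.
  have hN : (6 * p ^ (2 * α + 2) * n + (6 * i + p) * p ^ (2 * α + 1)) % 6 = 1 := by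
    have h2 : p % 2 = 1 := Nat.odd_iff.mp (hpp.odd_of_ne_two (by omega))
    have h3 : p % 3 ≠ 0 := fun h ↦ by
      have := (Nat.prime_dvd_prime_iff_eq Nat.prime_three hpp).mp (Nat.dvd_of_mod_eq_zero h)
      omega
    have h1 : (p ^ 2) % 6 = 1 := by
      rw [Nat.pow_mod]
      have : p % 6 = 1 ∨ p % 6 = 5 := by omega
      rcases this with h | h <;> rw [h]
    have h4 : p ^ (2 * α + 2) % 6 = 1 := by
      rw [show 2 * α + 2 = 2 * (α + 1) by ring, pow_mul, Nat.pow_mod, h1, one_pow, Nat.one_mod]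
    rw [show 6 * p ^ (2 * α + 2) * n + (6 * i + p) * p ^ (2 * α + 1) =
      p ^ (2 * α + 2) + 6 * (p ^ (2 * α + 2) * n + i * p ^ (2 * α + 1)) by ring,
      Nat.add_mul_mod_self_left, h4]
  -- The index is `p ^ (2 α + 1)` times a number congruent to `6 i` modulo `p`.
  have hempty : IsEmpty {z : ℤ × ℤ // z.1.natAbs ^ 2 + 3 * z.2.natAbs ^ 2 =
      6 * p ^ (2 * α + 2) * n + (6 * i + p) * p ^ (2 * α + 1)} := ⟨fun z ↦ by
    have h := z.2
    zify at h
    simp only [sq_abs] at h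
    have hd : (p : ℤ) ∣ 6 * p * n + (6 * i + p) := dvd_of_sq_add_three_mul_sq_eq hp α
      (x := z.1.1) (y := z.1.2) (by rw [h]; ring)
    have hd' : p ∣ 6 * i := by
      have h6 : (p : ℤ) ∣ 6 * i := by
        rw [show (6 * i : ℤ) = 6 * p * n + (6 * i + p) - p * (6 * n + 1) by ring]
        exact dvd_sub hd (dvd_mul_right _ _)
      exact_mod_cast h6
    rcases hpp.dvd_mul.mp hd' with h | h
    · have hle := Nat.le_of_dvd (by norm_num) h
      interval_cases p
      · omega
      · exact absurd hpp (by norm_num)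
    · have := Nat.le_of_dvd hi1 h
      omega⟩
  have h := intCast_tSchurOverpartition_nine hN
  rw [Nat.card_of_isEmpty, Nat.cast_zero, ZMod.intCast_zmod_eq_zero_iff_dvd] at h
  exact Int.modEq_zero_iff_dvd.mpr h
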